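/- Let $d\ge 1$, let $\mathscr H_d$ be the space of real symmetric $d\times d$ matrices with $\langle X,Y\rangle=\operatorname{tr}(XY^*)$, and let $I_d$ be the identity matrix. Fix $1\le k\le d$ and $\lambda=(\lambda_1,\dots,\lambda_d)$ with $1\ge\lambda_1\ge\dots\ge\lambda_k>\lambda_{k+1}=\dots=\lambda_d=0$. Put $D_\lambda=\operatorname{diag}(\lambda_1,\dots,\lambda_d)$, $s_i=\operatorname{tr}(D_\lambda^i)$ and $\mathcal G_{\lambda,d}=\{OD_\lambda O^*: O\in\mathcal O(d)\}$, and let $\sigma_{\lambda,d}$ be the image on $\mathcal G_{\lambda,d}$ of the normalized Haar measure of the orthogonal group $\mathcal O(d)$ under $O\mapsto OD_\lambda O^*$. A $\mathcal G_{\lambda,d}$-valued random variable $\mathcal P$ is called a random cubature of strength $t$ if $$\mathbb E\big(\langle\mathcal P,X\rangle^t\big)=\int_{\mathcal G_{\lambda,d}}\langle P,X\rangle^t\,d\sigma_{\lambda,d}(P)\qquad\text{for all }X\in\mathscr H_d.$$ (1) If $\mathcal P$ is a random cubature of strength $2$, $d\ge 2$, and $\lambda_1,\dots,\lambda_d$ are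 not all equal (equivalently, $ds_2\neq s_1^2$), then for all $X\in\mathscr H_d$ $$a_1\,\mathbb E\big(\langle\mathcal P,X\rangle\,\mathcal P\big)=X+a_2\operatorname{tr}(X)\,I_d,\qquad a_1=\frac{d(d+2)(d-1)}{-2s_1^2+2ds_2},\quad a_2=\frac{(d+1)s_1^2-2s_2}{-2s_1^2+2ds_2}.$$ (2) If $\mathcal P$ is a random cubature of strength $3$ and $d\ge 3$, then for all $X_1,X_2\in\mathscr H_d$ $$\mathbb E\big(\langle\mathcal P,X_1\rangle\langle\mathcal P,X_2\rangle\,\mathcal P\big)=\frac1{q_{3,d}}\Big(\alpha_{(1,1,1)}\operatorname{tr}(X_1)\operatorname{tr}(X_2)I_d+\frac{\alpha_{(2,1)}}3\big(\operatorname{tr}(X_1)X_2+\operatorname{tr}(X_2)X_1+\operatorname{tr}(X_1X_2)I_d\big)+\frac{\alpha_{(3)}}2\big(X_1X_2+X_2X_1\big)\Big),$$ where $$q_{3,d}=(d-2)(d-1)d(d+2)(d+4),$$ $$\alpha_{(1,1,1)}=(d^2+3d-2)s_1^3-6(d+2)s_1s_2+16s_3,$$ $$\alpha_{(2,1)}=-6(d+2)s_1^3+6(d^2+2d+4)s_1s_2-24ds_3,$$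 $$\alpha_{(3)}=16s_1^3-24ds_1s_2+8d^2s_3.$$ In both parts the expectations exist. -/

import Mathlib

open MeasureTheory Matrix

noncomputable section

namespace TraceMoments

/-- Real `d × d` matrices, with the product (equivalently, Borel) sigma-algebra. -/
instance instMeasurableSpaceMatrix (d : ℕ) : MeasurableSpace (Matrix (Fin d) (Fin d) ℝ) :=
  inferInstanceAs (MeasurableSpace (Fin d → Fin d → ℝ))

instance instBorelSpaceMatrix (d : ℕ) : BorelSpace (Matrix (Fin d) (Fin d) ℝ) :=
  inferInstanceAs (BorelSpace (Fin d → Fin d → ℝ))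

/-- The orthogonal group is compact. -/
instance instCompactSpaceOrthogonalGroup (d : ℕ) :
    CompactSpace (Matrix.orthogonalGroup (Fin d) ℝ) := by
  have hbox : IsCompact
      (Set.univ.pi fun _ : Fin d => Set.univ.pi fun _ : Fin d => Set.Icc (-1 : ℝ) 1) :=
    isCompact_univ_pi fun _ => isCompact_univ_pi fun _ => isCompact_Icc
  have hclosed : IsClosed
      ((Matrix.orthogonalGroup (Fin d) ℝ : Set (Matrix (Fin d) (Fin d) ℝ))) := by
    have h : ((Matrix.orthogonalGroup (Fin d) ℝ : Set (Matrix (Fin d) (Fin d) ℝ)))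
        = {A | A * Aᵀ = 1} := by
      ext A
      exact Matrix.mem_orthogonalGroup_iff (Fin d) ℝ
    rw [h]
    exact isClosed_eq (by fun_prop) continuous_const
  refine isCompact_iff_compactSpace.mp (IsCompact.of_isClosed_subset hbox hclosed ?_)
  intro A hA i _ j _
  have h := entry_norm_bound_of_unitary (𝕜 := ℝ) hA i j
  rw [Real.norm_eq_abs] at h
  exact abs_le.mp h

/-- The normalized Haar measure on the orthogonal group. -/
def haarOrthogonal (d : ℕ) : Measure (Matrix.orthogonalGroup (Fin d) ℝ) :=
  Measure.haarMeasure ⊤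

/-- The Hilbert-Schmidt inner product `⟨X, Y⟩ = tr (X Y*)`. -/
def hsInner {d : ℕ} (X Y : Matrix (Fin d) (Fin d) ℝ) : ℝ :=
  (X * Yᵀ).trace

/-- The standing assumption on `lam`, with indices starting from `0`:
`1 ≥ lam 0 ≥ … ≥ lam (k - 1) > 0` and `lam k = … = lam (d - 1) = 0`. -/
structure IsSpectrum {d : ℕ} (k : ℕ) (lam : Fin d → ℝ) : Prop where
  one_le : 1 ≤ k
  le_dim : k ≤ d
  le_one : ∀ i, lam i ≤ 1
  antitone : Antitone lam
  pos : ∀ i : Fin d, (i : ℕ) < k → 0 < lam i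
  eq_zero : ∀ i : Fin d, k ≤ (i : ℕ) → lam i = 0

/-- The orbit `{O D Oᵀ : O ∈ O(d)}` of `D = diag lam`. -/
def orbit {d : ℕ} (lam : Fin d → ℝ) : Set (Matrix (Fin d) (Fin d) ℝ) :=
  {A | ∃ O ∈ Matrix.orthogonalGroup (Fin d) ℝ, A = O * Matrix.diagonal lam * Oᵀ}

/-- The orthogonally invariant probability measure on the orbit of `diag lam`: the image of the
normalized Haar measure under `O ↦ O D Oᵀ`, as a measure on the space of all matrices. -/
def orbitMeasure {d : ℕ} (lam : Fin d → ℝ) : Measure (Matrix (Fin d) (Fin d) ℝ) :=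
  (haarOrthogonal d).map fun O : Matrix.orthogonalGroup (Fin d) ℝ =>
    (O : Matrix (Fin d) (Fin d) ℝ) * Matrix.diagonal lam * (O : Matrix (Fin d) (Fin d) ℝ)ᵀ

/-- The trace moment of degree `t` of a random matrix `P`. -/
def traceMoment {d : ℕ} {Ω : Type*} [MeasurableSpace Ω] (ℙ : Measure Ω) (t : ℕ)
    (P : Ω → Matrix (Fin d) (Fin d) ℝ) (X : Matrix (Fin d) (Fin d) ℝ) : ℝ :=
  ∫ ω, hsInner (P ω) X ^ t ∂ℙ

/-- The trace moment of degree `t` of the invariant measure on the orbit of `diag lam`. -/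
def orbitTraceMoment {d : ℕ} (lam : Fin d → ℝ) (t : ℕ) (X : Matrix (Fin d) (Fin d) ℝ) : ℝ :=
  ∫ A, hsInner A X ^ t ∂(orbitMeasure lam)

/-- `P` is a random cubature of strength `t` in the orbit of `diag lam`: an orbit-valued random
variable whose trace moments of degree `t` agree with those of the invariant measure on all
symmetric matrices. -/
structure IsRandomCubature {d : ℕ} (lam : Fin d → ℝ) (t : ℕ) {Ω : Type*} [MeasurableSpace Ω]
    (ℙ : Measure Ω) (P : Ω → Matrix (Fin d) (Fin d) ℝ) : Prop where
  measurable : Measurable P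
  mem_orbit : ∀ ω, P ω ∈ orbit lam
  moment_eq : ∀ X : Matrix (Fin d) (Fin d) ℝ, X.IsSymm →
    traceMoment ℙ t P X = orbitTraceMoment lam t X

/-- All entries of the random matrix `M` are integrable, so that its expectation exists. -/
def HasExpectation {d : ℕ} {Ω : Type*} [MeasurableSpace Ω] (ℙ : Measure Ω)
    (M : Ω → Matrix (Fin d) (Fin d) ℝ) : Prop :=
  ∀ i j, Integrable (fun ω => M ω i j) ℙ

/-- The (entrywise) expectation of a random matrix. -/
def expectation {d : ℕ} {Ω : Type*} [MeasurableSpace Ω] (ℙ : Measure Ω)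
    (M : Ω → Matrix (Fin d) (Fin d) ℝ) : Matrix (Fin d) (Fin d) ℝ :=
  Matrix.of fun i j => ∫ ω, M ω i j ∂ℙ

/-- The power sum `s i = tr (D ^ i)` for `D = diag lam`. -/
def s {d : ℕ} (lam : Fin d → ℝ) (i : ℕ) : ℝ :=
  (Matrix.diagonal lam ^ i).trace

def a₁ {d : ℕ} (lam : Fin d → ℝ) : ℝ :=
  (d : ℝ) * ((d : ℝ) + 2) * ((d : ℝ) - 1) / (-2 * s lam 1 ^ 2 + 2 * (d : ℝ) * s lam 2)

def a₂ {d : ℕ} (lam : Fin d → ℝ) : ℝ :=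
  (((d : ℝ) + 1) * s lam 1 ^ 2 - 2 * s lam 2) / (-2 * s lam 1 ^ 2 + 2 * (d : ℝ) * s lam 2)

def q₃ (d : ℕ) : ℝ :=
  ((d : ℝ) - 2) * ((d : ℝ) - 1) * (d : ℝ) * ((d : ℝ) + 2) * ((d : ℝ) + 4)

def α₁₁₁ {d : ℕ} (lam : Fin d → ℝ) : ℝ :=
  ((d : ℝ) ^ 2 + 3 * (d : ℝ) - 2) * s lam 1 ^ 3 - 6 * ((d : ℝ) + 2) * s lam 1 * s lam 2
    + 16 * s lam 3

def α₂₁ {d : ℕ} (lam : Fin d → ℝ) : ℝ :=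
  -6 * ((d : ℝ) + 2) * s lam 1 ^ 3 + 6 * ((d : ℝ) ^ 2 + 2 * (d : ℝ) + 4) * s lam 1 * s lam 2
    - 24 * (d : ℝ) * s lam 3

def α₃ {d : ℕ} (lam : Fin d → ℝ) : ℝ :=
  16 * s lam 1 ^ 3 - 24 * (d : ℝ) * s lam 1 * s lam 2 + 8 * (d : ℝ) ^ 2 * s lam 3

end TraceMoments

end

/-! The Haar integral is never evaluated. Left invariance makes the moment of the orbit measure a
function of `X` invariant under orthogonal conjugation. After diagonalizing `X`, it is a homogeneous
polynomial in the eigenvalues, and conjugation by permutation matrices makes that polynomial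
symmetric. Degree two therefore leaves two unknown coefficients and degree three leaves three,
multiplying products of traces of powers of `X` (`orbitTraceMoment_two`, `orbitTraceMoment_three`).

A cubature has the same moments on symmetric matrices. Polarization turns them into mixed moments,
and testing against symmetrized elementary matrices reads off the entries of the required
expectation.

The coefficients come from the orbit itself, on which tr `P ω`^i is the constant `s lam i`.
Integrating the products of such traces of total degree 2 or 3 gives as many linear equations as
unknowns (`quadratic_coefficient_relations`, `cubic_coefficient_relations`). Eliminating yields the
stated constants. -/

namespace TraceMoments

variable {d : ℕ}

/-! ### Compactness of the orbit and invariance of its measure -/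

/-- The orbit map `O ↦ O D Oᵀ` of `D = diag lam`. -/
noncomputable def orbitMap (lam : Fin d → ℝ) (O : Matrix.orthogonalGroup (Fin d) ℝ) :
    Matrix (Fin d) (Fin d) ℝ :=
  (O : Matrix (Fin d) (Fin d) ℝ) * Matrix.diagonal lam * (O : Matrix (Fin d) (Fin d) ℝ)ᵀ

lemma continuous_orbitMap (lam : Fin d → ℝ) : Continuous (orbitMap lam) := by
  unfold orbitMap; fun_prop

lemma isCompact_orbit (lam : Fin d → ℝ) : IsCompact (orbit lam) := by
  have : orbit lam = Set.range (orbitMap lam) := by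
    ext A
    constructor
    · rintro ⟨O, hO, rfl⟩
      exact ⟨⟨O, hO⟩, rfl⟩
    · rintro ⟨O, rfl⟩
      exact ⟨O, O.2, rfl⟩
  rw [this]
  exact isCompact_range (continuous_orbitMap lam)

/-- A continuous function is bounded on the compact orbit and the measure is finite; every
expectation in the theorem exists for this reason. -/
lemma integrable_comp_of_mem_orbit {lam : Fin d → ℝ} {Ω : Type*} [MeasurableSpace Ω]
    {ℙ : Measure Ω} [IsFiniteMeasure ℙ] {P : Ω → Matrix (Fin d) (Fin d) ℝ}
    (hP : Measurable P) (hmem : ∀ ω, P ω ∈ orbit lam)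
    {g : Matrix (Fin d) (Fin d) ℝ → ℝ} (hg : Continuous g) :
    Integrable (fun ω => g (P ω)) ℙ := by
  obtain ⟨C, hC⟩ := (isCompact_orbit lam).exists_bound_of_continuousOn hg.continuousOn
  exact Integrable.of_bound (hg.measurable.comp hP).aestronglyMeasurable C
    (Filter.Eventually.of_forall fun ω => hC _ (hmem ω))

instance : IsProbabilityMeasure (haarOrthogonal d) :=
  ⟨by
    have h := Measure.haarMeasure_self
      (K₀ := (⊤ : TopologicalSpace.PositiveCompacts (Matrix.orthogonalGroup (Fin d) ℝ)))
    rwa [TopologicalSpace.PositiveCompacts.coe_top] at h⟩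

instance : (haarOrthogonal d).IsMulLeftInvariant := by
  unfold haarOrthogonal; infer_instance

/-- Conjugating by `U` sends the orbit point of `O` to that of `U * O`, so left invariance of Haar
measure applies. -/
lemma integral_orbitMap_conj (lam : Fin d → ℝ) (g : Matrix (Fin d) (Fin d) ℝ → ℝ)
    {U : Matrix (Fin d) (Fin d) ℝ} (hU : U ∈ Matrix.orthogonalGroup (Fin d) ℝ) :
    ∫ O, g (U * orbitMap lam O * Uᵀ) ∂(haarOrthogonal d) =
      ∫ O, g (orbitMap lam O) ∂(haarOrthogonal d) := by
  rw [← integral_mul_left_eq_self (fun O => g (orbitMap lam O)) (⟨U, hU⟩ : orthogonalGroup (Fin d) ℝ)]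
  congr with O
  simp [orbitMap, Matrix.mul_assoc]

lemma orbitTraceMoment_eq (lam : Fin d → ℝ) (t : ℕ) (X : Matrix (Fin d) (Fin d) ℝ) :
    orbitTraceMoment lam t X = ∫ O, hsInner (orbitMap lam O) X ^ t ∂(haarOrthogonal d) := by
  unfold orbitTraceMoment orbitMeasure
  change ∫ A, _ ∂((haarOrthogonal d).map (orbitMap lam)) = _
  rw [integral_map (continuous_orbitMap lam).measurable.aemeasurable]
  · apply Continuous.aestronglyMeasurable
    unfold hsInner; fun_prop

lemma hsInner_conj {U : Matrix (Fin d) (Fin d) ℝ} (hU : U ∈ Matrix.orthogonalGroup (Fin d) ℝ)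
    (A X : Matrix (Fin d) (Fin d) ℝ) :
    hsInner (U * A * Uᵀ) (U * X * Uᵀ) = hsInner A X := by
  have h : Uᵀ * U = 1 := (mem_orthogonalGroup_iff' (Fin d) ℝ).1 hU
  unfold hsInner
  calc (U * A * Uᵀ * (U * X * Uᵀ)ᵀ).trace = (U * (A * (Uᵀ * U) * Xᵀ * Uᵀ)).trace := by
        simp only [transpose_mul, transpose_transpose, Matrix.mul_assoc]
    _ = (A * Xᵀ).trace := by
        rw [trace_mul_comm, Matrix.mul_assoc _ Uᵀ U, h, Matrix.mul_one, Matrix.mul_one]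

lemma orbitTraceMoment_conj (lam : Fin d → ℝ) (t : ℕ) {U : Matrix (Fin d) (Fin d) ℝ}
    (hU : U ∈ Matrix.orthogonalGroup (Fin d) ℝ) (X : Matrix (Fin d) (Fin d) ℝ) :
    orbitTraceMoment lam t (U * X * Uᵀ) = orbitTraceMoment lam t X := by
  simp only [orbitTraceMoment_eq]
  rw [← integral_orbitMap_conj lam (fun A => hsInner A (U * X * Uᵀ) ^ t) hU]
  simp only [hsInner_conj hU]

/-! ### Diagonalization and permutation matrices -/

lemma exists_orthogonal_diagonalization {X : Matrix (Fin d) (Fin d) ℝ} (hX : X.IsSymm) :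
    ∃ U ∈ Matrix.orthogonalGroup (Fin d) ℝ, ∃ x : Fin d → ℝ, X = U * diagonal x * Uᵀ := by
  have hX' : X.IsHermitian := by rwa [IsHermitian, conjTranspose_eq_transpose_of_trivial]
  exact ⟨hX'.eigenvectorUnitary, hX'.eigenvectorUnitary.2, hX'.eigenvalues,
    hX'.spectral_theorem⟩

lemma trace_conj_pow {U : Matrix (Fin d) (Fin d) ℝ} (hU : U ∈ Matrix.orthogonalGroup (Fin d) ℝ)
    (X : Matrix (Fin d) (Fin d) ℝ) (n : ℕ) :
    ((U * X * Uᵀ) ^ n).trace = (X ^ n).trace := by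
  have h : Uᵀ * U = 1 := (mem_orthogonalGroup_iff' (Fin d) ℝ).1 hU
  have h' : U * Uᵀ = 1 := (mem_orthogonalGroup_iff (Fin d) ℝ).1 hU
  have key : (U * X * Uᵀ) ^ n = U * X ^ n * Uᵀ := by
    induction n with
    | zero => simp [h']
    | succ n ih =>
      calc (U * X * Uᵀ) ^ (n + 1) = U * X ^ n * (Uᵀ * U) * X * Uᵀ := by
            rw [pow_succ, ih]; simp only [Matrix.mul_assoc]
        _ = U * X ^ (n + 1) * Uᵀ := by
            rw [h, Matrix.mul_one, pow_succ]; simp only [Matrix.mul_assoc]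
  rw [key, trace_mul_cycle, h, Matrix.one_mul]

lemma trace_diagonal_pow (x : Fin d → ℝ) (n : ℕ) :
    (diagonal x ^ n).trace = ∑ i, x i ^ n := by
  simp [diagonal_pow, trace_diagonal]

lemma permMatrix_mem_orthogonalGroup (σ : Equiv.Perm (Fin d)) :
    σ.permMatrix ℝ ∈ Matrix.orthogonalGroup (Fin d) ℝ := by
  rw [mem_orthogonalGroup_iff]
  change σ.permMatrix ℝ * (σ.permMatrix ℝ)ᵀ = 1
  rw [transpose_permMatrix, ← permMatrix_mul]
  simp

lemma permMatrix_conj_apply (σ : Equiv.Perm (Fin d)) (A : Matrix (Fin d) (Fin d) ℝ)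
    (i j : Fin d) : (σ.permMatrix ℝ * A * (σ.permMatrix ℝ)ᵀ) i j = A (σ i) (σ j) := by
  rw [transpose_permMatrix]
  simp [Equiv.Perm.permMatrix, PEquiv.toMatrix_toPEquiv_mul, PEquiv.mul_toMatrix_toPEquiv]
  rfl

lemma exists_perm_two {i j i' j' : Fin d} (h : i ≠ j) (h' : i' ≠ j') :
    ∃ σ : Equiv.Perm (Fin d), σ i = i' ∧ σ j = j' := by
  have hf : Function.Injective ![i, j] := by
    intro a b; fin_cases a <;> fin_cases b <;> simp [h, h.symm]
  have hf' : Function.Injective ![i', j'] := by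
    intro a b; fin_cases a <;> fin_cases b <;> simp [h', h'.symm]
  have := Equiv.Perm.isMultiplyPretransitive (Fin d) 2
  obtain ⟨σ, hσ⟩ := MulAction.exists_smul_eq (Equiv.Perm (Fin d))
    (⟨_, hf⟩ : Fin 2 ↪ Fin d) ⟨_, hf'⟩
  exact ⟨σ, DFunLike.congr_fun hσ 0, DFunLike.congr_fun hσ 1⟩

lemma exists_perm_three {i j k i' j' k' : Fin d} (hij : i ≠ j) (hik : i ≠ k) (hjk : j ≠ k)
    (hij' : i' ≠ j') (hik' : i' ≠ k') (hjk' : j' ≠ k') :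
    ∃ σ : Equiv.Perm (Fin d), σ i = i' ∧ σ j = j' ∧ σ k = k' := by
  have hf : Function.Injective ![i, j, k] := by
    intro a b; fin_cases a <;> fin_cases b <;> simp [hij, hik, hjk, hij.symm, hik.symm, hjk.symm]
  have hf' : Function.Injective ![i', j', k'] := by
    intro a b
    fin_cases a <;> fin_cases b <;> simp [hij', hik', hjk', hij'.symm, hik'.symm, hjk'.symm]
  have := Equiv.Perm.isMultiplyPretransitive (Fin d) 3
  obtain ⟨σ, hσ⟩ := MulAction.exists_smul_eq (Equiv.Perm (Fin d))
    (⟨_, hf⟩ : Fin 3 ↪ Fin d) ⟨_, hf'⟩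
  exact ⟨σ, DFunLike.congr_fun hσ 0, DFunLike.congr_fun hσ 1, DFunLike.congr_fun hσ 2⟩

/-! ### Permutation-invariant arrays -/

/-- A permutation-invariant array of order two is a combination of `1` and `δ i j`. -/
lemma exists_eq_of_perm_invariant_two (hd : 2 ≤ d) {m : Fin d → Fin d → ℝ}
    (hm : ∀ (σ : Equiv.Perm (Fin d)) i j, m (σ i) (σ j) = m i j) :
    ∃ a b : ℝ, ∀ i j, m i j = a + b * (if i = j then 1 else 0) := by
  let u : Fin d := ⟨0, by omega⟩
  let v : Fin d := ⟨1, by omega⟩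
  have huv : u ≠ v := by simp [u, v]
  refine ⟨m u v, m u u - m u v, fun i j => ?_⟩
  by_cases hij : i = j
  · subst hij
    have := hm (Equiv.swap u i) u u
    simp only [Equiv.swap_apply_left] at this
    simp [this]
  · obtain ⟨σ, rfl, rfl⟩ := exists_perm_two huv hij
    rw [hm]; simp [huv]

/-- A symmetric permutation-invariant array of order three is a combination of `1`,
`δ i j + δ j k + δ i k` and `δ i j * δ j k`. -/
lemma exists_eq_of_perm_invariant_three (hd : 3 ≤ d) {m : Fin d → Fin d → Fin d → ℝ}
    (hm : ∀ (σ : Equiv.Perm (Fin d)) i j k, m (σ i) (σ j) (σ k) = m i j k)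
    (h₁₂ : ∀ i j k, m j i k = m i j k) (h₂₃ : ∀ i j k, m i k j = m i j k) :
    ∃ a b c : ℝ, ∀ i j k, m i j k = a
      + b * ((if i = j then 1 else 0) + (if j = k then 1 else 0) + (if i = k then 1 else 0))
      + c * ((if i = j then 1 else 0) * (if j = k then 1 else 0)) := by
  let u : Fin d := ⟨0, by omega⟩
  let v : Fin d := ⟨1, by omega⟩
  let w : Fin d := ⟨2, by omega⟩
  have huv : u ≠ v := by simp [u, v]
  have huw : u ≠ w := by simp [u, w]
  have hvw : v ≠ w := by simp [v, w]
  have hpair : ∀ i k, i ≠ k → m i i k = m u u v := by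
    intro i k h
    obtain ⟨σ, rfl, rfl⟩ := exists_perm_two huv h
    exact hm _ _ _ _
  -- The values on distinct, exactly two equal, and all equal indices must be `a`, `a + b` and `a +
  -- 3 * b + c`. The hypothesis `3 ≤ d` supplies a distinct triple.
  refine ⟨m u v w, m u u v - m u v w, m u u u - 3 * m u u v + 2 * m u v w, fun i j k => ?_⟩
  by_cases hij : i = j
  · subst hij
    by_cases hik : i = k
    · subst hik
      have := hm (Equiv.swap u i) u u u
      simp only [Equiv.swap_apply_left] at this
      simp only [if_true, this]; ring
    · simp only [hik, if_true, if_false, hpair i k hik]; ring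
  · by_cases hjk : j = k
    · subst hjk
      rw [← h₁₂, ← h₂₃, hpair j i (Ne.symm hij)]
      simp [hij]
    · by_cases hik : i = k
      · subst hik
        rw [← h₂₃, hpair i j hij]
        simp [hij, hjk]
      · obtain ⟨σ, rfl, rfl, rfl⟩ := exists_perm_three huv huw hvw hij hik hjk
        rw [hm]; simp [huv, huw, hvw]

/-! ### Invariant moments as polynomials in traces of powers -/

lemma hsInner_diagonal (A : Matrix (Fin d) (Fin d) ℝ) (x : Fin d → ℝ) :
    hsInner A (diagonal x) = ∑ i, x i * A i i := by
  simp [hsInner, trace, mul_diagonal, mul_comm]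

lemma integrable_orbitMap (lam : Fin d → ℝ) {g : Matrix (Fin d) (Fin d) ℝ → ℝ}
    (hg : Continuous g) : Integrable (fun O => g (orbitMap lam O)) (haarOrthogonal d) :=
  integrable_comp_of_mem_orbit (lam := lam) (continuous_orbitMap lam).measurable
    (fun O => ⟨O, O.2, rfl⟩) hg

lemma orbitTraceMoment_two (hd : 2 ≤ d) (lam : Fin d → ℝ) :
    ∃ a b : ℝ, ∀ X : Matrix (Fin d) (Fin d) ℝ, X.IsSymm →
      orbitTraceMoment lam 2 X = a * X.trace ^ 2 + b * (X ^ 2).trace := by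
  obtain ⟨a, b, hab⟩ := exists_eq_of_perm_invariant_two hd
    (m := fun i j => ∫ O, orbitMap lam O i i * orbitMap lam O j j ∂(haarOrthogonal d))
    (fun σ i j => by
      rw [← integral_orbitMap_conj lam (fun A => A i i * A j j)
        (permMatrix_mem_orthogonalGroup σ)]
      simp only [permMatrix_conj_apply])
  refine ⟨a, b, fun X hX => ?_⟩
  obtain ⟨U, hU, x, rfl⟩ := exists_orthogonal_diagonalization hX
  have h1 := trace_conj_pow hU (diagonal x) 1
  simp only [pow_one] at h1
  rw [orbitTraceMoment_conj lam 2 hU, trace_conj_pow hU, h1, trace_diagonal_pow, trace_diagonal,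
    orbitTraceMoment_eq]
  calc ∫ O, hsInner (orbitMap lam O) (diagonal x) ^ 2 ∂(haarOrthogonal d)
      = ∫ O, ∑ i, ∑ j, x i * x j * (orbitMap lam O i i * orbitMap lam O j j)
          ∂(haarOrthogonal d) := by
        congr with O
        rw [hsInner_diagonal, pow_two, Finset.sum_mul_sum]
        exact Finset.sum_congr rfl fun i _ => Finset.sum_congr rfl fun j _ => by ring
    _ = ∑ i, ∑ j, x i * x j * (a + b * (if i = j then 1 else 0)) := by
        rw [integral_finsetSum _ fun i _ =>
          integrable_orbitMap lam (g := fun A => ∑ j, x i * x j * (A i i * A j j)) (by fun_prop)]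
        refine Finset.sum_congr rfl fun i _ => ?_
        rw [integral_finsetSum _ fun j _ =>
          integrable_orbitMap lam (g := fun A => x i * x j * (A i i * A j j)) (by fun_prop)]
        refine Finset.sum_congr rfl fun j _ => ?_
        rw [integral_const_mul, hab]
    _ = a * (∑ i, x i) ^ 2 + b * ∑ i, x i ^ 2 := by
        simp only [mul_add, Finset.sum_add_distrib, mul_ite, mul_one, mul_zero,
          Finset.sum_ite_eq, Finset.mem_univ, if_true]
        simp only [← Finset.sum_mul, ← Finset.mul_sum, pow_two]
        ring

lemma orbitTraceMoment_three (hd : 3 ≤ d) (lam : Fin d → ℝ) :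
    ∃ a b c : ℝ, ∀ X : Matrix (Fin d) (Fin d) ℝ, X.IsSymm →
      orbitTraceMoment lam 3 X =
        a * X.trace ^ 3 + b * (X.trace * (X ^ 2).trace) + c * (X ^ 3).trace := by
  obtain ⟨a, b, c, habc⟩ := exists_eq_of_perm_invariant_three hd
    (m := fun i j k => ∫ O, orbitMap lam O i i * orbitMap lam O j j * orbitMap lam O k k
      ∂(haarOrthogonal d))
    (fun σ i j k => by
      rw [← integral_orbitMap_conj lam (fun A => A i i * A j j * A k k)
        (permMatrix_mem_orthogonalGroup σ)]
      simp only [permMatrix_conj_apply])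
    (fun i j k => by congr with O; ring) (fun i j k => by congr with O; ring)
  -- Each of the three single deltas contributes the same product tr X · tr X².
  refine ⟨a, 3 * b, c, fun X hX => ?_⟩
  obtain ⟨U, hU, x, rfl⟩ := exists_orthogonal_diagonalization hX
  have h1 := trace_conj_pow hU (diagonal x) 1
  simp only [pow_one] at h1
  rw [orbitTraceMoment_conj lam 3 hU, trace_conj_pow hU, trace_conj_pow hU, h1,
    trace_diagonal_pow, trace_diagonal_pow, trace_diagonal, orbitTraceMoment_eq]
  calc ∫ O, hsInner (orbitMap lam O) (diagonal x) ^ 3 ∂(haarOrthogonal d)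
      = ∫ O, ∑ i, ∑ j, ∑ k, x i * x j * x k *
          (orbitMap lam O i i * orbitMap lam O j j * orbitMap lam O k k)
          ∂(haarOrthogonal d) := by
        congr with O
        rw [hsInner_diagonal, pow_three', Finset.sum_mul_sum, Finset.sum_mul]
        refine Finset.sum_congr rfl fun i _ => ?_
        rw [Finset.sum_mul]
        refine Finset.sum_congr rfl fun j _ => ?_
        rw [Finset.mul_sum]
        exact Finset.sum_congr rfl fun k _ => by ring
    _ = ∑ i, ∑ j, ∑ k, x i * x j * x k * (a
      + b * ((if i = j then 1 else 0) + (if j = k then 1 else 0) + (if i = k then 1 else 0))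
      + c * ((if i = j then 1 else 0) * (if j = k then 1 else 0))) := by
        rw [integral_finsetSum _ fun i _ => integrable_orbitMap lam
          (g := fun A => ∑ j, ∑ k, x i * x j * x k * (A i i * A j j * A k k)) (by fun_prop)]
        refine Finset.sum_congr rfl fun i _ => ?_
        rw [integral_finsetSum _ fun j _ => integrable_orbitMap lam
          (g := fun A => ∑ k, x i * x j * x k * (A i i * A j j * A k k)) (by fun_prop)]
        refine Finset.sum_congr rfl fun j _ => ?_
        rw [integral_finsetSum _ fun k _ => integrable_orbitMap lam
          (g := fun A => x i * x j * x k * (A i i * A j j * A k k)) (by fun_prop)]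
        refine Finset.sum_congr rfl fun k _ => ?_
        rw [integral_const_mul, habc]
    _ = a * (∑ i, x i) ^ 3 + 3 * b * ((∑ i, x i) * ∑ i, x i ^ 2) + c * ∑ i, x i ^ 3 := by
        have e1 : ∑ i, ∑ j, ∑ k, x i * x j * x k = (∑ i, x i) ^ 3 := by
          simp only [← Finset.sum_mul, ← Finset.mul_sum, pow_three']
        have e2 : ∑ i, ∑ k, x i * x i * x k = (∑ i, x i) * ∑ i, x i ^ 2 := by
          simp only [← Finset.sum_mul, ← Finset.mul_sum, pow_two]; ring
        have e3 : ∑ i, ∑ j, x i * x j * x j = (∑ i, x i) * ∑ i, x i ^ 2 := by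
          simp only [mul_assoc, ← Finset.sum_mul, ← Finset.mul_sum, pow_two]
        have e4 : ∑ i, ∑ j, x i * x j * x i = (∑ i, x i) * ∑ i, x i ^ 2 := by
          rw [← e2]
          exact Finset.sum_congr rfl fun i _ => Finset.sum_congr rfl fun j _ => by ring
        have e5 : ∑ i, x i * x i * x i = ∑ i, x i ^ 3 := by simp only [pow_three']
        have f2 : ∑ i, ∑ j, ∑ k, x i * x j * x k * (if i = j then 1 else 0)
            = (∑ i, x i) * ∑ i, x i ^ 2 := by
          rw [← e2]
          refine Finset.sum_congr rfl fun i _ => ?_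
          -- The delta ties `i` to `j`, so the sum over `j` is moved innermost for it to collapse.
          rw [Finset.sum_comm]
          simp
        have f3 : ∑ i, ∑ j, ∑ k, x i * x j * x k * (if j = k then 1 else 0)
            = (∑ i, x i) * ∑ i, x i ^ 2 := by
          rw [← e3]; simp
        have f4 : ∑ i, ∑ j, ∑ k, x i * x j * x k * (if i = k then 1 else 0)
            = (∑ i, x i) * ∑ i, x i ^ 2 := by
          rw [← e4]; simp
        have f5 : ∑ i, ∑ j, ∑ k, x i * x j * x k *
            ((if i = j then 1 else 0) * (if j = k then 1 else 0)) = ∑ i, x i ^ 3 := by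
          rw [← e5]; simp
        calc _ = a * (∑ i, ∑ j, ∑ k, x i * x j * x k)
              + b * ((∑ i, ∑ j, ∑ k, x i * x j * x k * (if i = j then 1 else 0))
                + (∑ i, ∑ j, ∑ k, x i * x j * x k * (if j = k then 1 else 0))
                + (∑ i, ∑ j, ∑ k, x i * x j * x k * (if i = k then 1 else 0)))
              + c * (∑ i, ∑ j, ∑ k, x i * x j * x k *
                ((if i = j then 1 else 0) * (if j = k then 1 else 0))) := by
              simp only [Finset.mul_sum, ← Finset.sum_add_distrib]
              exact Finset.sum_congr rfl fun i _ => Finset.sum_congr rfl fun j _ =>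
                Finset.sum_congr rfl fun k _ => by ring
          _ = _ := by rw [e1, f2, f3, f4, f5]; ring

/-! ### Test matrices and power sums on the orbit -/

/-- Transposition reverses the product. With cyclicity this makes the cubic trace a symmetric
trilinear form, so its polarization has a single term. -/
lemma trace_mul_mul_of_isSymm {X Y Z : Matrix (Fin d) (Fin d) ℝ} (hX : X.IsSymm)
    (hY : Y.IsSymm) (hZ : Z.IsSymm) : (X * (Y * Z)).trace = (X * (Z * Y)).trace := by
  rw [← trace_transpose, transpose_mul, transpose_mul, hX.eq, hY.eq, hZ.eq, trace_mul_comm]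

/-- The symmetric elementary matrix, which picks out the entry `(i, j)` of symmetric matrices. -/
noncomputable def symmSingle (i j : Fin d) : Matrix (Fin d) (Fin d) ℝ :=
  (1 / 2 : ℝ) • (single i j 1 + single j i 1)

lemma isSymm_symmSingle (i j : Fin d) : (symmSingle i j).IsSymm := by
  simp [symmSingle, IsSymm, add_comm]

lemma symmSingle_apply (i j k l : Fin d) :
    symmSingle i j k l = ((if i = k then 1 else 0) * (if j = l then 1 else 0)
      + (if j = k then 1 else 0) * (if i = l then 1 else 0)) / 2 := by
  simp only [symmSingle, Matrix.smul_apply, Matrix.add_apply, single_apply, smul_eq_mul, ite_and]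
  split_ifs <;> norm_num

lemma mul_symmSingle_apply (X : Matrix (Fin d) (Fin d) ℝ) (i j k l : Fin d) :
    (X * symmSingle i j) k l =
      (X k i * (if j = l then 1 else 0) + X k j * (if i = l then 1 else 0)) / 2 := by
  simp only [mul_apply, symmSingle_apply, mul_div_assoc', mul_add, ← Finset.sum_div,
    Finset.sum_add_distrib]
  simp

lemma trace_mul_symmSingle (Y : Matrix (Fin d) (Fin d) ℝ) (i j : Fin d) :
    (Y * symmSingle i j).trace = (Y i j + Y j i) / 2 := by
  simp [symmSingle, Matrix.mul_add, trace_mul_single]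
  ring

lemma trace_symmSingle (i j : Fin d) :
    (symmSingle i j).trace = (1 : Matrix (Fin d) (Fin d) ℝ) i j := by
  rw [← Matrix.one_mul (symmSingle i j), trace_mul_symmSingle, (isSymm_one).apply i j]
  ring

lemma hsInner_symmSingle {A : Matrix (Fin d) (Fin d) ℝ} (hA : A.IsSymm) (i j : Fin d) :
    hsInner A (symmSingle i j) = A i j := by
  rw [hsInner, (isSymm_symmSingle i j).eq, trace_mul_symmSingle, hA.apply i j]
  ring

lemma hsInner_one (A : Matrix (Fin d) (Fin d) ℝ) : hsInner A 1 = A.trace := by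
  simp [hsInner]

lemma continuous_hsInner (X : Matrix (Fin d) (Fin d) ℝ) : Continuous fun A => hsInner A X := by
  unfold hsInner; fun_prop

lemma hsInner_add (A X Y : Matrix (Fin d) (Fin d) ℝ) :
    hsInner A (X + Y) = hsInner A X + hsInner A Y := by
  simp [hsInner, Matrix.mul_add]

lemma hsInner_sub (A X Y : Matrix (Fin d) (Fin d) ℝ) :
    hsInner A (X - Y) = hsInner A X - hsInner A Y := by
  simp [hsInner, Matrix.mul_sub]

lemma isSymm_of_mem_orbit {lam : Fin d → ℝ} {A : Matrix (Fin d) (Fin d) ℝ}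
    (hA : A ∈ orbit lam) : A.IsSymm := by
  obtain ⟨O, -, rfl⟩ := hA
  simp [IsSymm, Matrix.mul_assoc]

lemma trace_pow_of_mem_orbit {lam : Fin d → ℝ} {A : Matrix (Fin d) (Fin d) ℝ}
    (hA : A ∈ orbit lam) (n : ℕ) : (A ^ n).trace = s lam n := by
  obtain ⟨O, hO, rfl⟩ := hA
  exact trace_conj_pow hO _ _

lemma trace_of_mem_orbit {lam : Fin d → ℝ} {A : Matrix (Fin d) (Fin d) ℝ}
    (hA : A ∈ orbit lam) : A.trace = s lam 1 := by
  rw [← trace_pow_of_mem_orbit hA, pow_one]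

lemma sum_sq_of_mem_orbit {lam : Fin d → ℝ} {A : Matrix (Fin d) (Fin d) ℝ}
    (hA : A ∈ orbit lam) : ∑ i, ∑ j, A i j * A i j = s lam 2 := by
  rw [← trace_pow_of_mem_orbit hA, pow_two]
  simp only [trace, diag, mul_apply]
  exact Finset.sum_congr rfl fun i _ => Finset.sum_congr rfl fun j _ => by
    rw [(isSymm_of_mem_orbit hA).apply i j]

lemma sum_cube_of_mem_orbit {lam : Fin d → ℝ} {A : Matrix (Fin d) (Fin d) ℝ}
    (hA : A ∈ orbit lam) : ∑ i, ∑ j, ∑ k, A i j * A j k * A k i = s lam 3 := by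
  rw [← trace_pow_of_mem_orbit hA, pow_three']
  simp only [trace, diag, mul_apply, Finset.sum_mul]
  exact Finset.sum_congr rfl fun i _ => Finset.sum_comm

/-- Writing the denominator of `a₁` and `a₂` as a sum of squares shows that it vanishes only for a
constant spectrum. -/
lemma sum_sq_sub (lam : Fin d → ℝ) :
    ∑ i, ∑ j, (lam i - lam j) ^ 2 = -2 * s lam 1 ^ 2 + 2 * (d : ℝ) * s lam 2 := by
  simp only [s, trace_diagonal_pow]
  have h : ∀ i j, (lam i - lam j) ^ 2 = lam i ^ 2 - 2 * (lam i * lam j) + lam j ^ 2 :=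
    fun i j => by ring
  simp only [h, Finset.sum_add_distrib, Finset.sum_sub_distrib, ← Finset.mul_sum,
    ← Finset.sum_mul, pow_one, Finset.sum_const, Finset.card_univ, Fintype.card_fin, nsmul_eq_mul]
  ring

lemma power_sum_gap_ne_zero {lam : Fin d → ℝ} (h : ¬ ∀ i j, lam i = lam j) :
    -2 * s lam 1 ^ 2 + 2 * (d : ℝ) * s lam 2 ≠ 0 := by
  rw [← sum_sq_sub]
  contrapose! h
  intro i j
  have h1 := (Finset.sum_eq_zero_iff_of_nonneg fun i _ =>
    Finset.sum_nonneg fun j _ => sq_nonneg (lam i - lam j)).1 h i (Finset.mem_univ i)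
  have h2 := (Finset.sum_eq_zero_iff_of_nonneg fun j _ =>
    sq_nonneg (lam i - lam j)).1 h1 j (Finset.mem_univ j)
  exact sub_eq_zero.1 (pow_eq_zero_iff two_ne_zero |>.1 h2)

/-! ### Polarization of the moments -/

section Moments

variable {lam : Fin d → ℝ} {Ω : Type*} [MeasurableSpace Ω] {ℙ : Measure Ω}
  [IsProbabilityMeasure ℙ] {P : Ω → Matrix (Fin d) (Fin d) ℝ}

lemma integral_hsInner_mul_hsInner (hP : Measurable P) (hmem : ∀ ω, P ω ∈ orbit lam) {a b : ℝ}
    (h : ∀ X : Matrix (Fin d) (Fin d) ℝ, X.IsSymm →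
      ∫ ω, hsInner (P ω) X ^ 2 ∂ℙ = a * X.trace ^ 2 + b * (X ^ 2).trace)
    {X Y : Matrix (Fin d) (Fin d) ℝ} (hX : X.IsSymm) (hY : Y.IsSymm) :
    ∫ ω, hsInner (P ω) X * hsInner (P ω) Y ∂ℙ =
      a * (X.trace * Y.trace) + b * (X * Y).trace := by
  have hint : ∀ Z : Matrix (Fin d) (Fin d) ℝ,
      Integrable (fun ω => hsInner (P ω) Z ^ 2) ℙ := fun Z =>
    integrable_comp_of_mem_orbit hP hmem ((continuous_hsInner Z).pow 2)
  calc ∫ ω, hsInner (P ω) X * hsInner (P ω) Y ∂ℙ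
      = ∫ ω, (1 / 4) * (hsInner (P ω) (X + Y) ^ 2 - hsInner (P ω) (X - Y) ^ 2) ∂ℙ := by
        congr with ω
        rw [hsInner_add, hsInner_sub]; ring
    _ = _ := by
        rw [integral_const_mul, integral_sub (hint _) (hint _), h _ (hX.add hY),
          h _ (hX.sub hY)]
        simp only [pow_two, Matrix.mul_add, Matrix.add_mul, Matrix.mul_sub, Matrix.sub_mul,
          trace_add, trace_sub, trace_mul_comm Y X]
        ring

lemma integral_hsInner_mul_hsInner_mul_hsInner (hP : Measurable P)
    (hmem : ∀ ω, P ω ∈ orbit lam) {a b c : ℝ}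
    (h : ∀ X : Matrix (Fin d) (Fin d) ℝ, X.IsSymm → ∫ ω, hsInner (P ω) X ^ 3 ∂ℙ =
      a * X.trace ^ 3 + b * (X.trace * (X ^ 2).trace) + c * (X ^ 3).trace)
    {X Y Z : Matrix (Fin d) (Fin d) ℝ} (hX : X.IsSymm) (hY : Y.IsSymm) (hZ : Z.IsSymm) :
    ∫ ω, hsInner (P ω) X * hsInner (P ω) Y * hsInner (P ω) Z ∂ℙ =
      a * (X.trace * Y.trace * Z.trace)
      + b / 3 * (X.trace * (Y * Z).trace + Y.trace * (X * Z).trace + Z.trace * (X * Y).trace)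
      + c * (X * Y * Z).trace := by
  have hint : ∀ Z : Matrix (Fin d) (Fin d) ℝ,
      Integrable (fun ω => hsInner (P ω) Z ^ 3) ℙ := fun Z =>
    integrable_comp_of_mem_orbit hP hmem ((continuous_hsInner Z).pow 3)
  calc ∫ ω, hsInner (P ω) X * hsInner (P ω) Y * hsInner (P ω) Z ∂ℙ
      -- Polarization: 24xyz = (x+y+z)³ − (x+y−z)³ − (x−y+z)³ − (y−x+z)³.
      = ∫ ω, (1 / 24) * (hsInner (P ω) (X + Y + Z) ^ 3 - hsInner (P ω) (X + Y - Z) ^ 3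
          - hsInner (P ω) (X - Y + Z) ^ 3 - hsInner (P ω) (Y - X + Z) ^ 3) ∂ℙ := by
        congr with ω
        simp only [hsInner_add, hsInner_sub]; ring
    _ = _ := by
        have hsub : ∀ {f g : Ω → ℝ}, Integrable f ℙ → Integrable g ℙ →
            Integrable (fun ω => f ω - g ω) ℙ := fun hf hg => hf.sub hg
        rw [integral_const_mul, integral_sub (hsub (hsub (hint _) (hint _)) (hint _)) (hint _),
          integral_sub (hsub (hint _) (hint _)) (hint _), integral_sub (hint _) (hint _),
          h _ ((hX.add hY).add hZ), h _ ((hX.add hY).sub hZ), h _ ((hX.sub hY).add hZ),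
          h _ ((hY.sub hX).add hZ)]
        have hcyc : ∀ A B C : Matrix (Fin d) (Fin d) ℝ,
            (B * (C * A)).trace = (A * (B * C)).trace := fun A B C => by
          rw [trace_mul_comm A, Matrix.mul_assoc]
        simp only [pow_two, pow_three, Matrix.mul_add, Matrix.add_mul, Matrix.mul_sub,
          Matrix.sub_mul, trace_add, trace_sub, Matrix.mul_assoc]
        -- Words in the matrices are brought to one representative per cyclic class; the classes of
        -- XYZ and XZY are then merged by symmetry.
        rw [trace_mul_comm Y X, trace_mul_comm Z X, trace_mul_comm Z Y,
          hcyc X Y Z, hcyc Y Z X, hcyc X Y Z, hcyc X Z Y, hcyc X Y X, hcyc X X Y,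
          hcyc Y Y X, hcyc X Y Y, hcyc X Z X, hcyc X X Z, hcyc Z Z X, hcyc X Z Z, hcyc Y Z Y,
          hcyc Y Y Z, hcyc Z Z Y, hcyc Y Z Z, ← hcyc Y X Z,
          trace_mul_mul_of_isSymm hX hZ hY]
        ring

end Moments

/-! ### Entries of the expectations and equations for the coefficients -/

section Moments

variable {lam : Fin d → ℝ} {Ω : Type*} [MeasurableSpace Ω] {ℙ : Measure Ω}
  [IsProbabilityMeasure ℙ] {P : Ω → Matrix (Fin d) (Fin d) ℝ}

lemma integral_hsInner_mul_apply (hP : Measurable P) (hmem : ∀ ω, P ω ∈ orbit lam) {a b : ℝ}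
    (h : ∀ X : Matrix (Fin d) (Fin d) ℝ, X.IsSymm →
      ∫ ω, hsInner (P ω) X ^ 2 ∂ℙ = a * X.trace ^ 2 + b * (X ^ 2).trace)
    {X : Matrix (Fin d) (Fin d) ℝ} (hX : X.IsSymm) (i j : Fin d) :
    ∫ ω, hsInner (P ω) X * P ω i j ∂ℙ =
      a * (X.trace * (1 : Matrix (Fin d) (Fin d) ℝ) i j) + b * X i j := by
  have key := integral_hsInner_mul_hsInner hP hmem h hX (isSymm_symmSingle i j)
  simp only [hsInner_symmSingle (isSymm_of_mem_orbit (hmem _)), trace_symmSingle,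
    trace_mul_symmSingle, hX.apply i j] at key
  rw [key]; ring

lemma integral_hsInner_mul_hsInner_mul_apply (hP : Measurable P)
    (hmem : ∀ ω, P ω ∈ orbit lam) {a b c : ℝ}
    (h : ∀ X : Matrix (Fin d) (Fin d) ℝ, X.IsSymm → ∫ ω, hsInner (P ω) X ^ 3 ∂ℙ =
      a * X.trace ^ 3 + b * (X.trace * (X ^ 2).trace) + c * (X ^ 3).trace)
    {X Y : Matrix (Fin d) (Fin d) ℝ} (hX : X.IsSymm) (hY : Y.IsSymm) (i j : Fin d) :
    ∫ ω, hsInner (P ω) X * hsInner (P ω) Y * P ω i j ∂ℙ =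
      a * (X.trace * Y.trace * (1 : Matrix (Fin d) (Fin d) ℝ) i j)
      + b / 3 * (X.trace * Y i j + Y.trace * X i j
        + (X * Y).trace * (1 : Matrix (Fin d) (Fin d) ℝ) i j)
      + c / 2 * ((X * Y) i j + (Y * X) i j) := by
  have key := integral_hsInner_mul_hsInner_mul_hsInner hP hmem h hX hY (isSymm_symmSingle i j)
  have hXY : (X * Y) j i = (Y * X) i j := by
    rw [← transpose_apply (X * Y), transpose_mul, hX.eq, hY.eq]
  simp only [hsInner_symmSingle (isSymm_of_mem_orbit (hmem _)), trace_symmSingle,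
    trace_mul_symmSingle, hX.apply i j, hY.apply i j, hXY] at key
  rw [key]; ring

/-- This is the trace of the symmetrization projector, hence the dimension of the space of symmetric
matrices. -/
lemma sum_symmSingle_apply_self :
    ∑ i : Fin d, ∑ j, symmSingle i j i j = ((d : ℝ) ^ 2 + d) / 2 := by
  simp only [symmSingle_apply, ← Finset.sum_div, Finset.sum_add_distrib]
  congr 1
  simp [pow_two]

lemma sum_one_apply_mul_self :
    ∑ i : Fin d, ∑ j, (1 : Matrix (Fin d) (Fin d) ℝ) i j * (1 : Matrix (Fin d) (Fin d) ℝ) i j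
      = d := by
  simp [one_apply]

/-- The linear relations between the coefficients of a quadratic trace moment and the power sums
of the spectrum. -/
lemma quadratic_coefficient_relations (hP : Measurable P) (hmem : ∀ ω, P ω ∈ orbit lam) {a b : ℝ}
    (h : ∀ X : Matrix (Fin d) (Fin d) ℝ, X.IsSymm →
      ∫ ω, hsInner (P ω) X ^ 2 ∂ℙ = a * X.trace ^ 2 + b * (X ^ 2).trace) :
    s lam 1 ^ 2 = a * (d : ℝ) ^ 2 + b * d ∧
      s lam 2 = a * d + b * (((d : ℝ) ^ 2 + d) / 2) := by
  constructor
  -- At `X = 1` the integrand is the constant (tr P)².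
  · simpa [hsInner_one, trace_of_mem_orbit (hmem _)] using h 1 isSymm_one
  · have hint : ∀ i j, Integrable (fun ω => P ω i j * P ω i j) ℙ := fun i j =>
      integrable_comp_of_mem_orbit hP hmem (g := fun A => A i j * A i j) (by fun_prop)
    calc s lam 2 = ∫ ω, ∑ i, ∑ j, P ω i j * P ω i j ∂ℙ := by
          simp [sum_sq_of_mem_orbit (hmem _)]
      _ = ∑ i, ∑ j, ∫ ω, P ω i j * P ω i j ∂ℙ := by
          rw [integral_finsetSum _ fun i _ => integrable_finsetSum _ fun j _ => hint i j]
          exact Finset.sum_congr rfl fun i _ => integral_finsetSum _ fun j _ => hint i j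
      _ = ∑ i : Fin d, ∑ j, (a * ((1 : Matrix (Fin d) (Fin d) ℝ) i j *
            (1 : Matrix (Fin d) (Fin d) ℝ) i j) + b * symmSingle i j i j) := by
          refine Finset.sum_congr rfl fun i _ => Finset.sum_congr rfl fun j _ => ?_
          rw [← trace_symmSingle i j, trace_symmSingle i j, ← trace_symmSingle i j]
          have := integral_hsInner_mul_apply hP hmem h (isSymm_symmSingle i j) i j
          simpa only [hsInner_symmSingle (isSymm_of_mem_orbit (hmem _)), trace_symmSingle]
            using this
      _ = _ := by
          simp only [Finset.sum_add_distrib, ← Finset.mul_sum, sum_symmSingle_apply_self,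
            sum_one_apply_mul_self]

lemma sum_one_apply_mul_mul :
    ∑ i : Fin d, ∑ j, ∑ k, (1 : Matrix (Fin d) (Fin d) ℝ) i j *
      (1 : Matrix (Fin d) (Fin d) ℝ) j k * (1 : Matrix (Fin d) (Fin d) ℝ) k i = d := by
  simp [one_apply]

lemma sum_one_apply_mul_symmSingle_apply :
    ∑ i : Fin d, ∑ j, ∑ k, ((1 : Matrix (Fin d) (Fin d) ℝ) i j * symmSingle j k k i
      + (1 : Matrix (Fin d) (Fin d) ℝ) j k * symmSingle i j k i
      + (symmSingle i j * symmSingle j k).trace * (1 : Matrix (Fin d) (Fin d) ℝ) k i)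
      = 3 * (((d : ℝ) ^ 2 + d) / 2) := by
  simp only [trace_mul_symmSingle, one_apply, symmSingle_apply, mul_div_assoc', mul_add, add_mul,
    div_mul_eq_mul_div, ← add_div, ← Finset.sum_div, Finset.sum_add_distrib]
  simp
  ring

/-- The two orders contribute differently: (d² + 3d)/4 and (d³ + 2d² + d)/4. Only in the second does
a term leave `i` free, which gives the cubic growth. -/
lemma sum_symmSingle_mul_symmSingle_apply :
    ∑ i : Fin d, ∑ j, ∑ k, ((symmSingle i j * symmSingle j k) k i
      + (symmSingle j k * symmSingle i j) k i) = ((d : ℝ) ^ 3 + 3 * (d : ℝ) ^ 2 + 4 * d) / 4 := by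
  simp only [mul_symmSingle_apply, symmSingle_apply, add_mul,
    div_mul_eq_mul_div, ← add_div, ← Finset.sum_div, Finset.sum_add_distrib]
  simp
  ring

/-- The linear relations between the coefficients of a cubic trace moment and the power sums
of the spectrum. -/
lemma cubic_coefficient_relations (hP : Measurable P) (hmem : ∀ ω, P ω ∈ orbit lam) {a b c : ℝ}
    (h : ∀ X : Matrix (Fin d) (Fin d) ℝ, X.IsSymm → ∫ ω, hsInner (P ω) X ^ 3 ∂ℙ =
      a * X.trace ^ 3 + b * (X.trace * (X ^ 2).trace) + c * (X ^ 3).trace) :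
    s lam 1 ^ 3 = a * (d : ℝ) ^ 3 + b * (d : ℝ) ^ 2 + c * d ∧
      s lam 1 * s lam 2 = a * (d : ℝ) ^ 2
        + b / 3 * (2 * d + d * (((d : ℝ) ^ 2 + d) / 2)) + c * (((d : ℝ) ^ 2 + d) / 2) ∧
      s lam 3 = a * d + b * (((d : ℝ) ^ 2 + d) / 2)
        + c * (((d : ℝ) ^ 3 + 3 * (d : ℝ) ^ 2 + 4 * d) / 8) := by
  refine ⟨?_, ?_, ?_⟩
  · simpa [hsInner_one, trace_of_mem_orbit (hmem _), pow_two] using h 1 isSymm_one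
  · have hint : ∀ i j, Integrable (fun ω => hsInner (P ω) 1 * P ω i j * P ω i j) ℙ := fun i j =>
      integrable_comp_of_mem_orbit hP hmem (g := fun A => hsInner A 1 * A i j * A i j)
        (by have := continuous_hsInner (1 : Matrix (Fin d) (Fin d) ℝ); fun_prop)
    calc s lam 1 * s lam 2 = ∫ ω, ∑ i, ∑ j, hsInner (P ω) 1 * P ω i j * P ω i j ∂ℙ := by
          simp only [mul_assoc, ← Finset.mul_sum, sum_sq_of_mem_orbit (hmem _), hsInner_one,
            trace_of_mem_orbit (hmem _)]
          simp
      _ = ∑ i, ∑ j, ∫ ω, hsInner (P ω) 1 * P ω i j * P ω i j ∂ℙ := by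
          rw [integral_finsetSum _ fun i _ => integrable_finsetSum _ fun j _ => hint i j]
          exact Finset.sum_congr rfl fun i _ => integral_finsetSum _ fun j _ => hint i j
      -- The mixed moment at `1` and `symmSingle i j`, with the terms collected.
      _ = ∑ i : Fin d, ∑ j, ((a * d + 2 * (b / 3)) * ((1 : Matrix (Fin d) (Fin d) ℝ) i j *
            (1 : Matrix (Fin d) (Fin d) ℝ) i j) + (b / 3 * d + c) * symmSingle i j i j) := by
          refine Finset.sum_congr rfl fun i _ => Finset.sum_congr rfl fun j _ => ?_
          have := integral_hsInner_mul_hsInner_mul_apply hP hmem h isSymm_one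
            (isSymm_symmSingle i j) i j
          simp only [hsInner_symmSingle (isSymm_of_mem_orbit (hmem _)), trace_symmSingle,
            Matrix.one_mul, Matrix.mul_one, trace_one, Fintype.card_fin] at this
          rw [this]; ring
      _ = _ := by
          simp only [Finset.sum_add_distrib, ← Finset.mul_sum, sum_symmSingle_apply_self,
            sum_one_apply_mul_self]
          ring
  · have hint : ∀ i j k, Integrable (fun ω => P ω i j * P ω j k * P ω k i) ℙ := fun i j k =>
      integrable_comp_of_mem_orbit hP hmem (g := fun A => A i j * A j k * A k i) (by fun_prop)
    calc s lam 3 = ∫ ω, ∑ i, ∑ j, ∑ k, P ω i j * P ω j k * P ω k i ∂ℙ := by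
          simp [sum_cube_of_mem_orbit (hmem _)]
      _ = ∑ i, ∑ j, ∑ k, ∫ ω, P ω i j * P ω j k * P ω k i ∂ℙ := by
          rw [integral_finsetSum _ fun i _ => integrable_finsetSum _ fun j _ =>
            integrable_finsetSum _ fun k _ => hint i j k]
          refine Finset.sum_congr rfl fun i _ => ?_
          rw [integral_finsetSum _ fun j _ => integrable_finsetSum _ fun k _ => hint i j k]
          exact Finset.sum_congr rfl fun j _ => integral_finsetSum _ fun k _ => hint i j k
      _ = ∑ i : Fin d, ∑ j, ∑ k, (a * ((1 : Matrix (Fin d) (Fin d) ℝ) i j *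
            (1 : Matrix (Fin d) (Fin d) ℝ) j k * (1 : Matrix (Fin d) (Fin d) ℝ) k i)
            + b / 3 * ((1 : Matrix (Fin d) (Fin d) ℝ) i j * symmSingle j k k i
              + (1 : Matrix (Fin d) (Fin d) ℝ) j k * symmSingle i j k i
              + (symmSingle i j * symmSingle j k).trace * (1 : Matrix (Fin d) (Fin d) ℝ) k i)
            + c / 2 * ((symmSingle i j * symmSingle j k) k i
              + (symmSingle j k * symmSingle i j) k i)) := by
          refine Finset.sum_congr rfl fun i _ => Finset.sum_congr rfl fun j _ =>
            Finset.sum_congr rfl fun k _ => ?_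
          have := integral_hsInner_mul_hsInner_mul_apply hP hmem h (isSymm_symmSingle i j)
            (isSymm_symmSingle j k) k i
          simpa only [hsInner_symmSingle (isSymm_of_mem_orbit (hmem _)), trace_symmSingle]
            using this
      _ = a * (d : ℝ) + b / 3 * (3 * (((d : ℝ) ^ 2 + d) / 2))
          + c / 2 * (((d : ℝ) ^ 3 + 3 * (d : ℝ) ^ 2 + 4 * d) / 4) := by
          rw [← sum_symmSingle_mul_symmSingle_apply, ← sum_one_apply_mul_symmSingle_apply,
            ← sum_one_apply_mul_mul]
          simp only [Finset.mul_sum, ← Finset.sum_add_distrib]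
      _ = _ := by ring

end Moments

end TraceMoments

/-! ### The two expectation formulas -/

theorem corollary7p4 {d k : ℕ} (lam : Fin d → ℝ) (hlam : TraceMoments.IsSpectrum k lam)
    {Ω : Type*} [MeasurableSpace Ω] (ℙ : Measure Ω) [IsProbabilityMeasure ℙ]
    (P : Ω → Matrix (Fin d) (Fin d) ℝ) :
    (TraceMoments.IsRandomCubature lam 2 ℙ P → 2 ≤ d → (¬ ∀ i j, lam i = lam j) →
      ∀ X : Matrix (Fin d) (Fin d) ℝ, X.IsSymm →
        TraceMoments.HasExpectation ℙ (fun ω => TraceMoments.hsInner (P ω) X • P ω) ∧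
        TraceMoments.a₁ lam •
            TraceMoments.expectation ℙ (fun ω => TraceMoments.hsInner (P ω) X • P ω)
          = X + (TraceMoments.a₂ lam * X.trace) • (1 : Matrix (Fin d) (Fin d) ℝ)) ∧
    (TraceMoments.IsRandomCubature lam 3 ℙ P → 3 ≤ d →
      ∀ X₁ X₂ : Matrix (Fin d) (Fin d) ℝ, X₁.IsSymm → X₂.IsSymm →
        TraceMoments.HasExpectation ℙ (fun ω =>
          (TraceMoments.hsInner (P ω) X₁ * TraceMoments.hsInner (P ω) X₂) • P ω) ∧
        TraceMoments.expectation ℙ (fun ω =>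
            (TraceMoments.hsInner (P ω) X₁ * TraceMoments.hsInner (P ω) X₂) • P ω)
          = (1 / TraceMoments.q₃ d) •
            ((TraceMoments.α₁₁₁ lam * (X₁.trace * X₂.trace)) • (1 : Matrix (Fin d) (Fin d) ℝ)
              + (TraceMoments.α₂₁ lam / 3) •
                (X₁.trace • X₂ + X₂.trace • X₁
                  + (X₁ * X₂).trace • (1 : Matrix (Fin d) (Fin d) ℝ))
              + (TraceMoments.α₃ lam / 2) • (X₁ * X₂ + X₂ * X₁))) := by
  open TraceMoments in
  refine ⟨fun hcub hd hne X hX => ⟨fun i j => ?_, ?_⟩,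
    fun hcub hd X Y hX hY => ⟨fun i j => ?_, ?_⟩⟩
  · exact integrable_comp_of_mem_orbit hcub.measurable hcub.mem_orbit
      (g := fun A => (hsInner A X • A) i j)
      (by have := continuous_hsInner X; simp only [Matrix.smul_apply]; fun_prop)
  · obtain ⟨a, b, hab⟩ := orbitTraceMoment_two hd lam
    have h : ∀ X : Matrix (Fin d) (Fin d) ℝ, X.IsSymm →
        ∫ ω, hsInner (P ω) X ^ 2 ∂ℙ = a * X.trace ^ 2 + b * (X ^ 2).trace :=
      fun X hX => (hcub.moment_eq X hX).trans (hab X hX)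
    obtain ⟨h1, h2⟩ := quadratic_coefficient_relations hcub.measurable hcub.mem_orbit h
    have hgap := power_sum_gap_ne_zero hne
    ext i j
    simp only [Matrix.smul_apply, Matrix.add_apply, expectation, of_apply, smul_eq_mul,
      integral_hsInner_mul_apply hcub.measurable hcub.mem_orbit h hX, a₁, a₂]
    -- Eliminating `a`, then `b`, from the two relations. The nonzero gap permits division and gives
    -- `a₁ * b = 1` and `a₁ * a = a₂`.
    have hb : (-2 * s lam 1 ^ 2 + 2 * (d : ℝ) * s lam 2)
        = b * ((d : ℝ) * ((d : ℝ) + 2) * ((d : ℝ) - 1)) := by rw [h1, h2]; ring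
    have ha : (((d : ℝ) + 1) * s lam 1 ^ 2 - 2 * s lam 2)
        = a * ((d : ℝ) * ((d : ℝ) + 2) * ((d : ℝ) - 1)) := by rw [h1, h2]; ring
    rw [div_mul_eq_mul_div, div_mul_eq_mul_div, div_mul_eq_mul_div, eq_comm, add_comm,
      div_add' _ _ _ hgap, ha, hb]
    ring
  · exact integrable_comp_of_mem_orbit hcub.measurable hcub.mem_orbit
      (g := fun A => ((hsInner A X * hsInner A Y) • A) i j)
      (by
        have := continuous_hsInner X
        have := continuous_hsInner Y
        simp only [Matrix.smul_apply]; fun_prop)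
  · obtain ⟨a, b, c, habc⟩ := orbitTraceMoment_three hd lam
    have h : ∀ X : Matrix (Fin d) (Fin d) ℝ, X.IsSymm → ∫ ω, hsInner (P ω) X ^ 3 ∂ℙ =
        a * X.trace ^ 3 + b * (X.trace * (X ^ 2).trace) + c * (X ^ 3).trace :=
      fun X hX => (hcub.moment_eq X hX).trans (habc X hX)
    obtain ⟨h1, h2, h3⟩ := cubic_coefficient_relations hcub.measurable hcub.mem_orbit h
    have hd' : (3 : ℝ) ≤ d := by exact_mod_cast hd
    have hq : q₃ d ≠ 0 := by
      have : 0 < (d : ℝ) - 2 := by linarith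
      have : 0 < (d : ℝ) - 1 := by linarith
      unfold q₃; positivity
    -- Each α is the combination of the three relations that isolates one coefficient, scaled by `q₃
    -- d`. Reassociating exposes the product `s lam 1 * s lam 2`, so that `h2` can be substituted.
    have ha : α₁₁₁ lam = a * q₃ d := by
      simp only [α₁₁₁, q₃, mul_assoc _ (s lam 1) (s lam 2), h1, h2, h3]; ring
    have hb : α₂₁ lam = b * q₃ d := by
      simp only [α₂₁, q₃, mul_assoc _ (s lam 1) (s lam 2), h1, h2, h3]; ring
    have hc : α₃ lam = c * q₃ d := by
      simp only [α₃, q₃, mul_assoc _ (s lam 1) (s lam 2), h1, h2, h3]; ring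
    ext i j
    simp only [Matrix.smul_apply, Matrix.add_apply, expectation, of_apply, smul_eq_mul,
      integral_hsInner_mul_hsInner_mul_apply hcub.measurable hcub.mem_orbit h hX hY, ha, hb, hc]
    field_simp
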